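/- Let $G=(V,E)$ be a finite simple planar graph with a fixed combinatorial embedding on the sphere (the cyclic order of the edges around every vertex together with the resulting faces; $G$ need not be connected), let $\Delta\ge 3$ be the maximum vertex degree of $G$, and let $s,t\in V$ be distinct. The extended dual $G^\star_{st}$ is the dual multigraph $G^\star$ together with two additional vertices $s$ and $t$, where $s$ (respectively $t$) is joined to every face of $G$ that has $s$ (respectively $t$) on its boundary. A path in $G^\star_{st}$ crosses the primal edges of the dual edges it contains; each crossed edge has one endpoint locally to the left and one endpoint locally to the right of the path. An $st$-path in $G^\star_{st}$ is consistent if there is a labeling $l\colon V\to\{L,R\}$ such that, for each edge $uv$ of $G$ crossed by the path with $u$ to the left and $v$ to the right, $l(u)=L$ and $l(v)=R$. Let $|p|$ denote the number of edges of a path $p$ in $G^\star_{st}$. If $p$ is a shortest $st$-path in $G^\star_{st}$, then there is a consistent $st$-path in $G^\star_{st}$ of length at most $(\Delta-2)\,|p|$. -/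

import Mathlib

universe u w

/-- A combinatorial embedding of the (finite, simple, not necessarily connected) graph `G` on the
sphere, with face set `F`; no face is distinguished as the outer face.  It consists of the
counterclockwise cyclic order of the edges around every vertex and of the assignment of the
boundary walks to the faces; planarity is expressed by Euler's formula.  A dart `d` is an edge
directed from `d.fst` to `d.snd`. -/
structure PlanarEmbedding {V : Type u} (G : SimpleGraph V) (F : Type w) where
  /-- `rot d` is the dart that follows `d` in counterclockwise order around `d.fst`. -/
  rot : Equiv.Perm G.Dart
  rot_fst : ∀ d, (rot d).fst = d.fst
  /-- The darts leaving a vertex form a single cycle of the rotation. -/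
  rot_sameCycle : ∀ d e : G.Dart, d.fst = e.fst → rot.SameCycle d e
  /-- The face to the left of a dart. -/
  left : G.Dart → F
  /-- When we walk along `d` with its left face on the left, the boundary walk continues at `d.snd`
  with the dart that follows the reverse of `d` in clockwise order. -/
  left_next : ∀ d : G.Dart, left (rot.symm d.symm) = left d
  /-- The face that contains an isolated vertex. -/
  around : {v : V // G.IsIsolated v} → F
  /-- The vertex-face incidence graph is connected. (If `G` is connected, this says that every
  face has a boundary walk.) -/
  connected : (SimpleGraph.fromRel fun x y : V ⊕ F => ∃ v f, x = Sum.inl v ∧ y = Sum.inr f ∧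
    ((∃ d : G.Dart, d.fst = v ∧ left d = f) ∨ ∃ h : G.IsIsolated v, around ⟨v, h⟩ = f)).Connected
  /-- Euler's formula `|V| - |E| + |F| = 1 + (number of connected components)`. Together with
  `connected` it says that every component of `G` is embedded in a sphere with one face per
  boundary walk, and that these spheres are joined along common faces in a tree-like way. -/
  euler : Nat.card V + Nat.card F = Nat.card G.edgeSet + 1 + Nat.card G.ConnectedComponent

namespace PlanarEmbedding

variable {V : Type u} {G : SimpleGraph V} {F : Type w}

/-- The face to the right of a dart. -/
def right (M : PlanarEmbedding G F) (d : G.Dart) : F := M.left d.symm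

/-- The vertex `v` lies on the boundary of the face `f`. -/
def Incident (M : PlanarEmbedding G F) (v : V) (f : F) : Prop :=
  (∃ d : G.Dart, d.fst = v ∧ M.left d = f) ∨ ∃ h : G.IsIsolated v, M.around ⟨v, h⟩ = f

/-- The vertices of the extended dual: the faces of `G`, and the two vertices `s` and `t`. -/
inductive ExtDual (M : PlanarEmbedding G F) (s t : V) : Type w
  | source : ExtDual M s t
  | sink : ExtDual M s t
  | face (f : F) : ExtDual M s t

/-- The edges of the extended dual (a multigraph), each in both of its directions:
the dual edge of every edge of `G`, and the edges that join `s` and `t` to their incident faces.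
`cross d` traverses the dual edge of `d` from the right side to the left side of `d`. -/
inductive Step (M : PlanarEmbedding G F) (s t : V) : ExtDual M s t → ExtDual M s t → Type (max u w)
  | leaveSource (f : F) (h : M.Incident s f) : Step M s t .source (.face f)
  | enterSource (f : F) (h : M.Incident s f) : Step M s t (.face f) .source
  | leaveSink (f : F) (h : M.Incident t f) : Step M s t .sink (.face f)
  | enterSink (f : F) (h : M.Incident t f) : Step M s t (.face f) .sink
  | cross (f g : F) (d : G.Dart) (hf : M.right d = f) (hg : M.left d = g) :
      Step M s t (.face f) (.face g)

instance (M : PlanarEmbedding G F) (s t : V) : Quiver (ExtDual M s t) where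
  Hom a b := Step M s t a b

/-- Walks from `s` to `t` in the extended dual. Their length is the number of their edges. -/
abbrev STWalk (M : PlanarEmbedding G F) (s t : V) : Type (max u w) :=
  Quiver.Path (ExtDual.source : ExtDual M s t) (ExtDual.sink : ExtDual M s t)

/-- The step crosses the edge underlying `d`, from the right side to the left side of `d`. -/
def Step.Crosses {M : PlanarEmbedding G F} {s t : V} {a b : ExtDual M s t} :
    Step M s t a b → G.Dart → Prop
  | .cross _ _ e _ _, d => e = d
  | _, _ => False

/-- The walk `p` crosses the edge underlying `d` from the right side to the left side of `d`.
Then the endpoint `d.fst` of this edge is to the left of `p`, and `d.snd` is to the right. -/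
def Crosses {M : PlanarEmbedding G F} {s t : V} {a : ExtDual M s t} :
    {b : ExtDual M s t} → Quiver.Path a b → G.Dart → Prop
  | _, .nil, _ => False
  | _, .cons p e, d => Crosses p d ∨ Step.Crosses e d

/-- The two labels of a labeling. -/
inductive Label
  | L
  | R

/-- The labeling `l` is compatible with (every edge crossed by) `p`. -/
def Compatible {M : PlanarEmbedding G F} {s t : V} (l : V → Label) (p : M.STWalk s t) : Prop :=
  ∀ d : G.Dart, Crosses p d → l d.fst = Label.L ∧ l d.snd = Label.R

/-- Some labeling of the vertices of `G` is compatible with `p`. -/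
def Consistent {M : PlanarEmbedding G F} {s t : V} (p : M.STWalk s t) : Prop :=
  ∃ l : V → Label, Compatible l p

/-- `p` is a path: no vertex of the extended dual is repeated. -/
def IsPath {M : PlanarEmbedding G F} {s t : V} (p : M.STWalk s t) : Prop :=
  p.vertices.Nodup

/-- `p` is a shortest `st`-path in the extended dual. -/
def IsShortestPath {M : PlanarEmbedding G F} {s t : V} (p : M.STWalk s t) : Prop :=
  IsPath p ∧ ∀ q : M.STWalk s t, IsPath q → p.length ≤ q.length

end PlanarEmbedding

/-!
If `Δ = 3`, every path of the extended dual is consistent (`consistent_of_isPath`): a vertex that is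
to the left of one crossed edge and to the right of another one has degree at most three, so these
two edges bound a common face at the vertex, and the path enters this face twice or leaves it twice.

If `Δ ≥ 4`, call two vertices cofacial if they share a face, and take a shortest sequence
`s = v₀, v₁, …, vₘ₊₁ = t` of successively cofacial vertices. Choosing an endpoint of each edge that
`p` crosses gives such a sequence, so `m + 2 ≤ |p|` (`exists_cofacialGraph_walk`). Adjacent vertices
are cofacial, so only consecutive `vᵢ` can be adjacent. Let `S = {v₁, …, vₘ}`. One can go from `s` to
`t` with `v₁, …, vₘ` closely on the left, turning counterclockwise around each of them, and likewise
with all of them closely on the right. If `vᵢ` and `vᵢ₊₁` are adjacent, one changes over from `vᵢ` to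
`vᵢ₊₁` in the face to the right, respectively to the left, of the edge `vᵢvᵢ₊₁`; then neither route
crosses an edge inside `S`, and each route is compatible with the labeling that separates `S` from
its complement (`exists_cutWalk_along`). At every `vᵢ` the two routes turn through disjoint sets of
edges (`exists_cutWalk_around`), so together they cross at most `Δ m` edges, and the shorter one has
at most `Δ m / 2 ≤ (Δ - 2) m` crossings. With the two edges at `s` and `t` its length is at most
`(Δ - 2) (m + 2)`. Finally a walk is shortened to a path that crosses only edges of the walk
(`exists_isPath_of_walk`).

The argument is local: Euler's formula does not enter.
-/

namespace PlanarEmbedding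

open Function

variable {V : Type u} {G : SimpleGraph V} {F : Type w}

/-! ### Paths in the extended dual -/

lemma exists_isPath_prefix {M : PlanarEmbedding G F} {s t : V} {a b : ExtDual M s t}
    (p : Quiver.Path a b) (hp : p.vertices.Nodup) {c : ExtDual M s t} (hc : c ∈ p.vertices) :
    ∃ q : Quiver.Path a c, q.vertices.Nodup ∧ q.length ≤ p.length ∧
      ∀ d, Crosses q d → Crosses p d := by
  induction p with
  | nil =>
    obtain rfl : c = a := by simpa using hc
    exact ⟨.nil, by simp, le_rfl, fun _ h => h⟩
  | cons p e ih =>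
    rcases (Quiver.Path.mem_vertices_cons p e).1 hc with h | rfl
    · have hp' : p.vertices.Nodup := by
        rw [Quiver.Path.vertices_cons, List.concat_eq_append] at hp
        exact hp.of_append_left
      obtain ⟨q, h1, h2, h3⟩ := ih hp' h
      exact ⟨q, h1, h2.trans (by simp), fun d hd => Or.inl (h3 d hd)⟩
    · exact ⟨p.cons e, hp, le_rfl, fun _ h => h⟩

/-- Cutting out closed subwalks keeps a walk compatible with a labeling, since the shortened walk
crosses only edges that the original one crosses, in the same direction. -/
lemma exists_isPath_of_walk {M : PlanarEmbedding G F} {s t : V} {a b : ExtDual M s t}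
    (p : Quiver.Path a b) :
    ∃ q : Quiver.Path a b, q.vertices.Nodup ∧ q.length ≤ p.length ∧
      ∀ d, Crosses q d → Crosses p d := by
  induction p with
  | nil => exact ⟨.nil, by simp, le_rfl, fun _ h => h⟩
  | @cons b c p e ih =>
    obtain ⟨q, h1, h2, h3⟩ := ih
    by_cases hc : c ∈ q.vertices
    · obtain ⟨r, k1, k2, k3⟩ := exists_isPath_prefix q h1 hc
      refine ⟨r, k1, ?_, fun d hd => Or.inl (h3 d (k3 d hd))⟩
      rw [Quiver.Path.length_cons]
      omega
    · refine ⟨q.cons e, ?_, by simpa using h2, fun d hd => hd.imp (h3 d) id⟩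
      rw [Quiver.Path.vertices_cons, List.concat_eq_append]
      exact h1.append (List.nodup_singleton c) (by simpa using hc)

lemma Step.Crosses.ends {M : PlanarEmbedding G F} {s t : V} {a b : ExtDual M s t}
    {e : Step M s t a b} {d : G.Dart} (h : e.Crosses d) :
    a = .face (M.right d) ∧ b = .face (M.left d) := by
  cases e <;> first | exact h.elim | skip
  cases h
  subst_vars
  exact ⟨rfl, rfl⟩

lemma Step.Crosses.unique {M : PlanarEmbedding G F} {s t : V} {a b : ExtDual M s t}
    {e : Step M s t a b} {d d' : G.Dart} (h : e.Crosses d) (h' : e.Crosses d') : d = d' := by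
  cases e <;> first | exact h.elim | skip
  exact Eq.trans (Eq.symm h) h'

lemma Crosses.left_mem {M : PlanarEmbedding G F} {s t : V} {a b : ExtDual M s t}
    {p : Quiver.Path a b} {d : G.Dart} (h : Crosses p d) :
    ExtDual.face (M.left d) ∈ p.vertices := by
  induction p with
  | nil => exact h.elim
  | cons p e ih =>
    rw [Quiver.Path.mem_vertices_cons]
    exact h.imp ih fun h => h.ends.2.symm

lemma Crosses.right_mem_dropLast {M : PlanarEmbedding G F} {s t : V} {a b : ExtDual M s t}
    {p : Quiver.Path a b} {d : G.Dart} (h : Crosses p d) :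
    ExtDual.face (M.right d) ∈ p.vertices.dropLast := by
  induction p with
  | nil => exact h.elim
  | cons p e ih =>
    rw [Quiver.Path.vertices_cons, List.concat_eq_append, List.dropLast_concat]
    rcases h with h | h
    · exact List.mem_of_mem_dropLast (ih h)
    · rw [← h.ends.1]
      exact p.end_mem_vertices

lemma nodup_vertices_cons_iff {Q : Type*} [Quiver Q] {a b c : Q} (p : Quiver.Path a b)
    (e : b ⟶ c) : (p.cons e).vertices.Nodup ↔ p.vertices.Nodup ∧ c ∉ p.vertices := by
  rw [Quiver.Path.vertices_cons, List.nodup_concat, and_comm]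

/-- A path enters every face at most once. -/
lemma eq_of_crosses_of_left_eq {M : PlanarEmbedding G F} {s t : V} {a b : ExtDual M s t}
    {p : Quiver.Path a b} (hp : p.vertices.Nodup) {d e : G.Dart} (hd : Crosses p d)
    (he : Crosses p e) (h : M.left d = M.left e) : d = e := by
  induction p with
  | nil => exact hd.elim
  | cons p x ih =>
    obtain ⟨hp, hx⟩ := (nodup_vertices_cons_iff p x).1 hp
    rcases hd with hd | hd <;> rcases he with he | he
    · exact ih hp hd he
    · exact (hx (by rw [he.ends.2, ← h]; exact hd.left_mem)).elim
    · exact (hx (by rw [hd.ends.2, h]; exact he.left_mem)).elim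
    · exact hd.unique he

/-- A path leaves every face at most once. -/
lemma eq_of_crosses_of_right_eq {M : PlanarEmbedding G F} {s t : V} {a b : ExtDual M s t}
    {p : Quiver.Path a b} (hp : p.vertices.Nodup) {d e : G.Dart} (hd : Crosses p d)
    (he : Crosses p e) (h : M.right d = M.right e) : d = e := by
  induction p with
  | nil => exact hd.elim
  | @cons b c p x ih =>
    obtain ⟨hp, -⟩ := (nodup_vertices_cons_iff p x).1 hp
    have key : ∀ d, Crosses p d → b ≠ .face (M.right d) := by
      rw [← p.dropLast_append_end_eq, List.nodup_append] at hp
      exact fun d hd hb => hp.2.2 _ hd.right_mem_dropLast _ (by simp) hb.symm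
    rcases hd with hd | hd <;> rcases he with he | he
    · exact ih hp hd he
    · exact (key d hd (h ▸ he.ends.1)).elim
    · exact (key e he (h ▸ hd.ends.1)).elim
    · exact hd.unique he

/-- A path does not cross an edge in both directions. -/
lemma not_crosses_symm {M : PlanarEmbedding G F} {s t : V} {a b : ExtDual M s t}
    {p : Quiver.Path a b} (hp : p.vertices.Nodup) {d : G.Dart} (hd : Crosses p d) :
    ¬ Crosses p d.symm := by
  intro he
  induction p with
  | nil => exact hd.elim
  | cons p x ih =>
    obtain ⟨hp, hx⟩ := (nodup_vertices_cons_iff p x).1 hp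
    rcases hd with hd | hd <;> rcases he with he | he
    · exact ih hp hd he
    · exact hx (by rw [he.ends.2]; exact List.mem_of_mem_dropLast hd.right_mem_dropLast)
    · refine hx ?_
      have := List.mem_of_mem_dropLast he.right_mem_dropLast
      rwa [right, SimpleGraph.Dart.symm_symm, ← hd.ends.2] at this
    · exact d.symm_ne (he.unique hd)

/-! ### Rotations and incidences -/

lemma right_rot (M : PlanarEmbedding G F) (d : G.Dart) : M.right (M.rot d) = M.left d := by
  have h := M.left_next (M.rot d).symm
  rw [SimpleGraph.Dart.symm_symm, Equiv.symm_apply_apply] at h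
  exact h.symm

lemma iterate_rot_fst (M : PlanarEmbedding G F) (d : G.Dart) (n : ℕ) :
    (M.rot^[n] d).fst = d.fst := by
  induction n with
  | zero => rfl
  | succ n ih => rw [iterate_succ_apply', M.rot_fst, ih]

lemma incident_left (M : PlanarEmbedding G F) (d : G.Dart) : M.Incident d.fst (M.left d) :=
  Or.inl ⟨d, rfl, rfl⟩

lemma incident_right (M : PlanarEmbedding G F) (d : G.Dart) : M.Incident d.fst (M.right d) := by
  refine Or.inl ⟨M.rot.symm d, ?_, ?_⟩
  · simpa using (M.rot_fst (M.rot.symm d)).symm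
  · simpa using (M.right_rot (M.rot.symm d)).symm

lemma minimalPeriod_rot_pos [Finite V] (M : PlanarEmbedding G F) (x : G.Dart) :
    0 < minimalPeriod M.rot x := by
  have : Finite G.Dart := Finite.of_injective _ SimpleGraph.Dart.toProd_injective
  exact minimalPeriod_pos_of_mem_periodicPts (M.rot.injective.mem_periodicPts x)

lemma minimalPeriod_rot_le [Fintype V] [DecidableRel G.Adj] (M : PlanarEmbedding G F)
    (x : G.Dart) : minimalPeriod M.rot x ≤ G.degree x.fst := by
  classical
  rw [← G.dart_fst_fiber_card_eq_degree x.fst, ← Finset.card_range (minimalPeriod M.rot x)]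
  refine Finset.card_le_card_of_injOn (fun n => M.rot^[n] x) (fun n _ => ?_) ?_
  · simpa using M.iterate_rot_fst x n
  · intro i hi j hj h
    exact iterate_injOn_Iio_minimalPeriod (by simpa using hi) (by simpa using hj) h

lemma exists_iterate_rot_eq [Finite V] (M : PlanarEmbedding G F) {x y : G.Dart}
    (h : x.fst = y.fst) : ∃ n < minimalPeriod M.rot x, M.rot^[n] x = y := by
  have : Finite G.Dart := Finite.of_injective _ SimpleGraph.Dart.toProd_injective
  obtain ⟨n, hn⟩ := (M.rot_sameCycle x y h).exists_nat_pow_eq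
  refine ⟨n % minimalPeriod M.rot x, Nat.mod_lt _ (M.minimalPeriod_rot_pos x), ?_⟩
  rw [iterate_mod_minimalPeriod_eq, ← hn, Equiv.Perm.coe_pow]

lemma iterate_rot_inj [Finite V] (M : PlanarEmbedding G F) {x : G.Dart} {i j : ℕ}
    (hi : 0 < i) (hi' : i ≤ minimalPeriod M.rot x) (hj : 0 < j)
    (hj' : j ≤ minimalPeriod M.rot x) (h : M.rot^[i] x = M.rot^[j] x) : i = j := by
  obtain ⟨i, rfl⟩ := Nat.exists_eq_succ_of_ne_zero hi.ne'
  obtain ⟨j, rfl⟩ := Nat.exists_eq_succ_of_ne_zero hj.ne'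
  rw [iterate_succ_apply', iterate_succ_apply'] at h
  have := iterate_injOn_Iio_minimalPeriod (f := M.rot) (x := x)
    (show i ∈ Set.Iio _ from hi') (show j ∈ Set.Iio _ from hj') (M.rot.injective h)
  rw [this]

/-- At a vertex of degree at most three, any two darts are consecutive in the rotation. -/
lemma rot_eq_or_rot_eq_of_degree_le_three [Fintype V] [DecidableRel G.Adj]
    (M : PlanarEmbedding G F) {x y : G.Dart} (h : x.fst = y.fst) (hxy : x ≠ y)
    (hdeg : G.degree x.fst ≤ 3) : M.rot x = y ∨ M.rot y = x := by
  obtain ⟨n, hn, rfl⟩ := M.exists_iterate_rot_eq h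
  have hN := M.minimalPeriod_rot_le x
  have h3 := iterate_minimalPeriod (f := M.rot) (x := x)
  obtain rfl | rfl | rfl : n = 0 ∨ n = 1 ∨ n = 2 := by omega
  · exact (hxy rfl).elim
  · exact Or.inl rfl
  · right
    rwa [show minimalPeriod M.rot x = 3 by omega] at h3

/-! ### Maximum degree three -/

/-- If a vertex were to the left of one crossed edge and to the right of another one, then these
edges would be consecutive around it, and the path would enter or leave the face between them
twice. -/
lemma consistent_of_isPath [Fintype V] [DecidableRel G.Adj] {M : PlanarEmbedding G F} {s t : V}
    (hdeg : G.maxDegree ≤ 3) {p : M.STWalk s t} (hp : IsPath p) : Consistent p := by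
  classical
  refine ⟨fun v => if ∃ d, Crosses p d ∧ d.fst = v then .L else .R, fun d hd =>
    ⟨if_pos ⟨d, hd, rfl⟩, if_neg ?_⟩⟩
  rintro ⟨e, he, hv⟩
  have hne : d ≠ e := by
    rintro rfl
    exact d.adj.ne hv
  have h : d ≠ e.symm := by
    rintro rfl
    exact not_crosses_symm hp he hd
  rcases M.rot_eq_or_rot_eq_of_degree_le_three (x := e) (y := d.symm) hv
    (fun h' => h (by rw [h', SimpleGraph.Dart.symm_symm]))
    ((G.degree_le_maxDegree _).trans hdeg) with h | h
  · refine hne (eq_of_crosses_of_left_eq hp hd he ?_)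
    rw [← M.right_rot e, h, right, SimpleGraph.Dart.symm_symm]
  · refine hne (eq_of_crosses_of_right_eq hp hd he ?_)
    rw [← h, M.right_rot]
    rfl

/-! ### Walks through a cut -/

/-- `CutWalk M S n f g`: there is a walk of length `n` from the face `f` to the face `g` in the
dual graph that crosses only edges with one endpoint in `S`, to the left of the walk, and the
other endpoint outside `S`, to the right. -/
inductive CutWalk (M : PlanarEmbedding G F) (S : Set V) : ℕ → F → F → Prop
  | nil (f : F) : CutWalk M S 0 f f
  | cons {n : ℕ} {f : F} (d : G.Dart) (hd : d.fst ∈ S) (hd' : d.snd ∉ S)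
      (h : CutWalk M S n f (M.right d)) : CutWalk M S (n + 1) f (M.left d)

lemma CutWalk.trans {M : PlanarEmbedding G F} {S : Set V} {m n : ℕ} {f g h : F}
    (h₁ : M.CutWalk S m f g) (h₂ : M.CutWalk S n g h) : M.CutWalk S (m + n) f h := by
  induction h₂ with
  | nil => exact h₁
  | cons d hd hd' _ ih => exact .cons d hd hd' (ih h₁)

/-- A cut walk between faces at `s` and `t` extends to a walk from `s` to `t`. -/
lemma CutWalk.exists_walk {M : PlanarEmbedding G F} {S : Set V} {s t : V} {n : ℕ} {f g : F}
    (h : M.CutWalk S n f g) (hf : M.Incident s f) (hg : M.Incident t g) :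
    ∃ q : M.STWalk s t, q.length = n + 2 ∧ ∀ d, Crosses q d → d.fst ∈ S ∧ d.snd ∉ S := by
  have key : ∃ q : Quiver.Path (ExtDual.source : ExtDual M s t) (ExtDual.face g),
      q.length = n + 1 ∧ ∀ d, Crosses q d → d.fst ∈ S ∧ d.snd ∉ S := by
    clear hg
    induction h with
    | nil f =>
      exact ⟨Quiver.Path.nil.cons (Step.leaveSource f hf), rfl, fun d hd => by
        rcases hd with hd | hd <;> exact hd.elim⟩
    | cons d hd hd' _ ih =>
      obtain ⟨q, hq, hq'⟩ := ih hf
      refine ⟨q.cons (Step.cross _ _ d rfl rfl), by rw [Quiver.Path.length_cons, hq], ?_⟩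
      rintro e (he | he)
      · exact hq' e he
      · cases he
        exact ⟨hd, hd'⟩
  obtain ⟨q, hq, hq'⟩ := key
  refine ⟨q.cons (Step.enterSink g hg), by rw [Quiver.Path.length_cons, hq], ?_⟩
  rintro e (he | he)
  · exact hq' e he
  · exact he.elim

/-- A cut walk from a face at `t` to a face at `s`, traversed backwards, gives a walk from `s` to
`t`; now the endpoints in `S` of the crossed edges are to the right. -/
lemma CutWalk.exists_walk_reverse {M : PlanarEmbedding G F} {S : Set V} {s t : V} {n : ℕ}
    {f g : F} (h : M.CutWalk S n g f) (hf : M.Incident s f) (hg : M.Incident t g) :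
    ∃ q : M.STWalk s t, q.length = n + 2 ∧ ∀ d, Crosses q d → d.fst ∉ S ∧ d.snd ∈ S := by
  have key : ∀ q : Quiver.Path (ExtDual.source : ExtDual M s t) (ExtDual.face f),
      (∀ d, Crosses q d → d.fst ∉ S ∧ d.snd ∈ S) → ∃ q' : M.STWalk s t,
        q'.length = q.length + n + 1 ∧ ∀ d, Crosses q' d → d.fst ∉ S ∧ d.snd ∈ S := by
    clear hf
    induction h with
    | nil f =>
      intro q hq
      refine ⟨q.cons (Step.enterSink f hg), rfl, ?_⟩
      rintro e (he | he)
      · exact hq e he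
      · exact he.elim
    | cons d hd hd' _ ih =>
      intro q hq
      obtain ⟨q', h1, h2⟩ := ih hg
        (q.cons (Step.cross (M.left d) (M.right d) d.symm
          (by rw [right, SimpleGraph.Dart.symm_symm]) rfl)) (by
        rintro e (he | he)
        · exact hq e he
        · cases he
          exact ⟨hd', hd⟩)
      refine ⟨q', ?_, h2⟩
      rw [h1, Quiver.Path.length_cons]
      omega
  obtain ⟨q, h1, h2⟩ := key (Quiver.Path.nil.cons (Step.leaveSource f hf)) (fun d hd => by
    rcases hd with hd | hd <;> exact hd.elim)
  exact ⟨q, by rw [h1, Quiver.Path.length_cons, Quiver.Path.length_nil]; omega, h2⟩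

/-! ### Walking around a vertex -/

/-- Turning around a vertex of `S` past edges that leave `S`. -/
lemma cutWalk_iterate_rot {M : PlanarEmbedding G F} {S : Set V} {x : G.Dart} (hx : x.fst ∈ S)
    (i n : ℕ) (h : ∀ l, i < l → l ≤ i + n → (M.rot^[l] x).snd ∉ S) :
    M.CutWalk S n (M.left (M.rot^[i] x)) (M.left (M.rot^[i + n] x)) := by
  induction n with
  | zero => exact .nil _
  | succ n ih =>
    refine .cons _ ?_ (h _ (by omega) le_rfl) ?_
    · rwa [M.iterate_rot_fst]
    · rw [← add_assoc, iterate_succ_apply', M.right_rot]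
      exact ih fun l hl hl' => h l hl (by omega)

/-- `r` and `l` are the faces to the right and to the left of the step from `v` to `w`: the two
sides of the edge if `v` and `w` are adjacent, and one common face of `v` and `w` otherwise. -/
def Gate (M : PlanarEmbedding G F) (v w : V) (r l : F) : Prop :=
  (∃ d : G.Dart, d.fst = v ∧ d.snd = w ∧ M.right d = r ∧ M.left d = l) ∨
    (¬ G.Adj v w ∧ r = l ∧ M.Incident v r ∧ M.Incident w r)

lemma Gate.symm {M : PlanarEmbedding G F} {v w : V} {r l : F} (h : M.Gate v w r l) :
    M.Gate w v l r := by
  rcases h with ⟨d, h1, h2, h3, h4⟩ | ⟨h1, rfl, h2, h3⟩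
  · exact Or.inl ⟨d.symm, h2, h1, by rw [right, SimpleGraph.Dart.symm_symm, h4], h3⟩
  · exact Or.inr ⟨fun h => h1 h.symm, rfl, h3, h2⟩

lemma Gate.incident {M : PlanarEmbedding G F} {v w : V} {r l : F} (h : M.Gate v w r l) :
    M.Incident v r ∧ M.Incident v l := by
  rcases h with ⟨d, rfl, -, rfl, rfl⟩ | ⟨-, rfl, h, -⟩
  · exact ⟨M.incident_right d, M.incident_left d⟩
  · exact ⟨h, h⟩

lemma exists_gate {M : PlanarEmbedding G F} {v w : V}
    (h : ∃ f, M.Incident v f ∧ M.Incident w f) : ∃ r l, M.Gate v w r l := by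
  by_cases ha : G.Adj v w
  · exact ⟨_, _, Or.inl ⟨⟨(v, w), ha⟩, rfl, rfl, rfl, rfl⟩⟩
  · obtain ⟨f, h1, h2⟩ := h
    exact ⟨f, f, Or.inr ⟨ha, rfl, h1, h2⟩⟩

/-- Let the vertex `v` of `S` have no neighbors in `S` other than `u` and `w`. Going from `u` over
`v` to `w`, one can pass `v` on its right side, and going back on its left side; together these two
detours cross every edge at `v` at most once. -/
lemma exists_cutWalk_around [Fintype V] [DecidableRel G.Adj] {M : PlanarEmbedding G F} {S : Set V}
    {u v w : V} (hv : v ∈ S) (huw : u ≠ w) (hS : ∀ z ∈ S, G.Adj v z → z = u ∨ z = w)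
    {f g h k : F} (hu : M.Gate u v f g) (hw : M.Gate v w h k) :
    ∃ n n', n + n' ≤ G.degree v ∧ M.CutWalk S n f h ∧ M.CutWalk S n' k g := by
  -- An isolated vertex lies on one face only, so there is nothing to cross.
  by_cases hiso : G.IsIsolated v
  · have hnd : ∀ d : G.Dart, d.fst ≠ v := by
      rintro d rfl
      exact hiso d.snd d.adj
    have hface : ∀ f, M.Incident v f → f = M.around ⟨v, hiso⟩ := by
      rintro f (⟨d, hd, -⟩ | ⟨-, rfl⟩)
      · exact (hnd d hd).elim
      · rfl
    rw [hface f hu.symm.incident.2, hface g hu.symm.incident.1, hface h hw.incident.1,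
      hface k hw.incident.2]
    exact ⟨0, 0, Nat.zero_le _, .nil _, .nil _⟩
  -- `x` is the edge to `u` if there is one (`a = 1`), and otherwise (`a = 0`) the dart clockwise
  -- before a corner of `f` at `v`.
  obtain ⟨x, a, hxv, hxf, ha, hxg, hxu, hau⟩ : ∃ (x : G.Dart) (a : ℕ), x.fst = v ∧ M.left x = f ∧
      a ≤ 1 ∧ M.left (M.rot^[minimalPeriod M.rot x - a] x) = g ∧
      (∀ d : G.Dart, d.fst = v → d.snd = u → d = x ∧ a = 1) ∧ (a = 1 → x.snd = u) := by
    have hpos := M.minimalPeriod_rot_pos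
    rcases hu.symm with ⟨d, h1, h2, h3, h4⟩ | ⟨h1, rfl, h2, -⟩
    · refine ⟨d, 1, h1, h4, le_rfl, ?_, fun e he he' => ⟨?_, rfl⟩, fun _ => ?_⟩
      · rw [← M.right_rot, ← iterate_succ_apply' (⇑M.rot), Nat.succ_eq_add_one,
          Nat.sub_add_cancel (hpos d), iterate_minimalPeriod, h3]
      · exact SimpleGraph.Dart.ext _ _ (Prod.ext (he.trans h1.symm) (he'.trans h2.symm))
      · exact h2
    · rcases h2 with ⟨d, hd, hd'⟩ | ⟨h2, -⟩
      · refine ⟨d, 0, hd, hd', Nat.zero_le _, by rw [Nat.sub_zero, iterate_minimalPeriod, hd'],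
          fun e he he' => (h1 ?_).elim, fun h => by cases h⟩
        rw [← he, ← he']
        exact e.adj
      · exact (hiso h2).elim
  -- `y` comes clockwise before the edge to `w` if there is one (`b = 1`), and otherwise (`b = 0`)
  -- before a corner of `h` at `v`.
  obtain ⟨y, b, hyv, hyh, hb, hyk, hyw, hbw⟩ : ∃ (y : G.Dart) (b : ℕ), y.fst = v ∧ M.left y = h ∧
      b ≤ 1 ∧ M.left (M.rot^[b] y) = k ∧
      (∀ d : G.Dart, d.fst = v → d.snd = w → d = M.rot y ∧ b = 1) ∧
      (b = 1 → (M.rot y).snd = w) := by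
    rcases hw with ⟨d, h1, h2, h3, h4⟩ | ⟨h1, rfl, h2, -⟩
    · refine ⟨M.rot.symm d, 1, ?_, ?_, le_rfl, ?_, fun e he he' => ⟨?_, rfl⟩, fun _ => ?_⟩
      · rw [← h1]
        simpa using (M.rot_fst (M.rot.symm d)).symm
      · rw [← h3]
        simpa using (M.right_rot (M.rot.symm d)).symm
      · rw [iterate_one, Equiv.apply_symm_apply, h4]
      · rw [Equiv.apply_symm_apply]
        exact SimpleGraph.Dart.ext _ _ (Prod.ext (he.trans h1.symm) (he'.trans h2.symm))
      · rw [Equiv.apply_symm_apply, h2]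
    · rcases h2 with ⟨d, hd, hd'⟩ | ⟨h2, -⟩
      · refine ⟨d, 0, hd, hd', Nat.zero_le _, hd', fun e he he' => (h1 ?_).elim, fun h => by cases h⟩
        rw [← he, ← he']
        exact e.adj
      · exact (hiso h2).elim
  obtain ⟨n, hn, rfl⟩ := M.exists_iterate_rot_eq (hxv.trans hyv.symm)
  have hdeg := M.minimalPeriod_rot_le x
  rw [hxv] at hdeg
  have hyk' : M.left (M.rot^[n + b] x) = k := by rw [add_comm, iterate_add_apply, hyk]
  -- In a full turn around `v` from `x`, only the edges to `u` and `w` can fail to leave `S`.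
  have hblock : ∀ l, 0 < l → l ≤ minimalPeriod M.rot x → (M.rot^[l] x).snd ∈ S →
      (l = minimalPeriod M.rot x ∧ a = 1) ∨ (l = n + 1 ∧ b = 1) := by
    intro l hl hl' hlS
    have hfst : (M.rot^[l] x).fst = v := by rw [M.iterate_rot_fst, hxv]
    rcases hS _ hlS (hfst ▸ (M.rot^[l] x).adj) with h | h
    · obtain ⟨h1, h2⟩ := hxu _ hfst h
      refine Or.inl ⟨M.iterate_rot_inj hl hl' (hl.trans_le hl') le_rfl ?_, h2⟩
      rw [h1, iterate_minimalPeriod]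
    · obtain ⟨h1, h2⟩ := hyw _ hfst h
      refine Or.inr ⟨M.iterate_rot_inj hl hl' (Nat.succ_pos n) hn ?_, h2⟩
      rw [h1, iterate_succ_apply']
  -- The two arcs do not overlap: a deficit would make the edges to `u` and `w` coincide.
  have hle : n + b + a ≤ minimalPeriod M.rot x := by
    by_contra hlt
    obtain ⟨rfl, rfl, h⟩ : a = 1 ∧ b = 1 ∧ n + 1 = minimalPeriod M.rot x := by omega
    have := hbw rfl
    rw [← iterate_succ_apply' (⇑M.rot), Nat.succ_eq_add_one, h, iterate_minimalPeriod, hau rfl]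
      at this
    exact huw this
  refine ⟨n, minimalPeriod M.rot x - a - (n + b), by omega, ?_, ?_⟩
  · rw [← hxf, ← hyh]
    have := cutWalk_iterate_rot (M := M) (S := S) (x := x) (hxv ▸ hv) 0 n fun l hl hl' hlS => by
      have := hblock l hl (by omega) hlS
      omega
    rwa [zero_add] at this
  · rw [← hxg, ← hyk']
    have := cutWalk_iterate_rot (M := M) (S := S) (x := x) (hxv ▸ hv) (n + b)
      (minimalPeriod M.rot x - a - (n + b)) fun l hl hl' hlS => by
        have := hblock l (by omega) (by omega) hlS
        omega
    rwa [show n + b + (minimalPeriod M.rot x - a - (n + b)) = minimalPeriod M.rot x - a by omega]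
      at this

/-! ### Vertices that share a face -/

/-- Two distinct vertices are adjacent if they lie on the boundary of a common face. -/
def cofacialGraph (M : PlanarEmbedding G F) : SimpleGraph V :=
  SimpleGraph.fromRel fun v w => ∃ f, M.Incident v f ∧ M.Incident w f

lemma cofacialGraph_adj {M : PlanarEmbedding G F} {v w : V} :
    M.cofacialGraph.Adj v w ↔ v ≠ w ∧ ∃ f, M.Incident v f ∧ M.Incident w f := by
  rw [cofacialGraph, SimpleGraph.fromRel_adj]
  refine and_congr_right fun _ => ⟨?_, Or.inl⟩
  rintro (h | ⟨f, h, h'⟩)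
  · exact h
  · exact ⟨f, h', h⟩

lemma cofacialGraph_adj_of_adj {M : PlanarEmbedding G F} {v w : V} (h : G.Adj v w) :
    M.cofacialGraph.Adj v w :=
  cofacialGraph_adj.2 ⟨h.ne, _, M.incident_left ⟨(v, w), h⟩, M.incident_right ⟨(w, v), h.symm⟩⟩

/-- Choosing an endpoint of every crossed edge turns a walk in the extended dual into a walk in the
cofacial graph. -/
lemma exists_cofacialGraph_walk {M : PlanarEmbedding G F} {s t : V} (p : M.STWalk s t) :
    ∃ c : M.cofacialGraph.Walk s t, c.length + 1 ≤ p.length := by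
  have step : ∀ {v w : V} {f : F} (c : M.cofacialGraph.Walk s v), M.Incident v f →
      M.Incident w f → ∃ c' : M.cofacialGraph.Walk s w, c'.length ≤ c.length + 1 := by
    intro v w f c hv hw
    by_cases h : v = w
    · subst h
      exact ⟨c, Nat.le_succ _⟩
    · exact ⟨c.concat (cofacialGraph_adj.2 ⟨h, f, hv, hw⟩), by
        rw [SimpleGraph.Walk.length_concat]⟩
  have key : ∀ {b : ExtDual M s t} (p : Quiver.Path (ExtDual.source : ExtDual M s t) b),
      (∀ f, b = .face f → ∃ v, M.Incident v f ∧
        ∃ c : M.cofacialGraph.Walk s v, c.length + 1 ≤ p.length) ∧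
      (b = .sink → ∃ c : M.cofacialGraph.Walk s t, c.length + 1 ≤ p.length) := by
    intro b p
    induction p with
    | nil => exact ⟨fun f h => (nomatch h), fun h => nomatch h⟩
    | @cons b c p e ih =>
      rw [Quiver.Path.length_cons]
      change Step M s t b c at e
      cases e with
      | leaveSource f h =>
        refine ⟨?_, fun h => by cases h⟩
        rintro _ ⟨⟩
        exact ⟨s, h, .nil, by simp⟩
      | enterSource f h => exact ⟨fun f h => (nomatch h), fun h => nomatch h⟩
      | leaveSink f h =>
        refine ⟨?_, fun h => by cases h⟩
        rintro _ ⟨⟩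
        obtain ⟨c, hc⟩ := ih.2 rfl
        exact ⟨t, h, c, by omega⟩
      | enterSink f h =>
        refine ⟨fun f h => (nomatch h), fun _ => ?_⟩
        obtain ⟨v, hv, c, hc⟩ := ih.1 f rfl
        obtain ⟨c', hc'⟩ := step c hv h
        exact ⟨c', by omega⟩
      | cross f g d hf hg =>
        refine ⟨?_, fun h => by cases h⟩
        rintro _ ⟨⟩
        obtain ⟨v, hv, c, hc⟩ := ih.1 f rfl
        obtain ⟨c', hc'⟩ := step c hv (hf ▸ M.incident_right d)
        exact ⟨d.fst, hg ▸ M.incident_left d, c', by omega⟩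
  exact (key p).2 rfl

/-- On a shortest walk, vertices that are adjacent are consecutive. -/
lemma le_succ_of_adj_getVert {W : Type*} {H : SimpleGraph W} {s t : W} (c : H.Walk s t)
    (hc : c.length = H.dist s t) {i j : ℕ} (hj : j ≤ c.length)
    (h : H.Adj (c.getVert i) (c.getVert j)) : j ≤ i + 1 := by
  by_contra hlt
  have := H.dist_le (((c.take i).concat h).append (c.drop j))
  rw [SimpleGraph.Walk.length_append, SimpleGraph.Walk.length_concat,
    SimpleGraph.Walk.take_length, SimpleGraph.Walk.drop_length] at this
  omega

/-- The inner vertices of a shortest walk `c` of the cofacial graph can be passed all on the right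
or, on the way back, all on the left; together the two routes cross at most `Δ` edges at each of
these vertices. -/
lemma exists_cutWalk_along [Fintype V] [DecidableRel G.Adj] {M : PlanarEmbedding G F} {s t : V}
    (c : M.cofacialGraph.Walk s t) (hc : c.length = M.cofacialGraph.dist s t) {m : ℕ}
    (hm : c.length = m + 1) :
    ∃ (S : Set V) (n n' : ℕ) (f g h k : F), n + n' ≤ G.maxDegree * m ∧
      M.Incident s f ∧ M.Incident s g ∧ M.Incident t h ∧ M.Incident t k ∧
      M.CutWalk S n f h ∧ M.CutWalk S n' k g := by
  have hinj : ∀ i j, i ≤ m + 1 → j ≤ m + 1 → c.getVert i = c.getVert j → i = j := by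
    intro i j hi hj h
    exact (c.isPath_of_length_eq_dist hc).getVert_injOn (by simpa [hm] using hi)
      (by simpa [hm] using hj) h
  have hgate : ∀ i, ∃ r l, i < m + 1 → M.Gate (c.getVert i) (c.getVert (i + 1)) r l := by
    intro i
    by_cases hi : i < m + 1
    · obtain ⟨r, l, h⟩ := exists_gate
        (cofacialGraph_adj.1 (c.adj_getVert_succ (hm ▸ hi))).2
      exact ⟨r, l, fun _ => h⟩
    · obtain ⟨r, l, -⟩ := exists_gate
        (cofacialGraph_adj.1 (c.adj_getVert_succ (hm ▸ Nat.succ_pos m : 0 < c.length))).2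
      exact ⟨r, l, fun h => (hi h).elim⟩
  choose r l hrl using hgate
  let S : Set V := {v | ∃ i, 0 < i ∧ i ≤ m ∧ c.getVert i = v}
  have key : ∀ i ≤ m, ∃ n n', n + n' ≤ G.maxDegree * i ∧ M.CutWalk S n (r 0) (r i) ∧
      M.CutWalk S n' (l i) (l 0) := by
    intro i
    induction i with
    | zero => exact fun _ => ⟨0, 0, Nat.zero_le _, .nil _, .nil _⟩
    | succ i ih =>
      intro hi
      obtain ⟨n, n', h1, h2, h3⟩ := ih (by omega)
      obtain ⟨k, k', h4, h5, h6⟩ := exists_cutWalk_around (S := S)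
        ⟨i + 1, Nat.succ_pos i, hi, rfl⟩
        (fun h => by have := hinj i (i + 2) (by omega) (by omega) h; omega)
        (by
          rintro _ ⟨j, hj, hj', rfl⟩ hadj
          have ha := cofacialGraph_adj_of_adj (M := M) hadj
          have h7 := le_succ_of_adj_getVert c hc (by omega) ha
          have h8 := le_succ_of_adj_getVert c hc (by omega) ha.symm
          have h9 : j ≠ i + 1 := by
            rintro rfl
            exact hadj.ne rfl
          obtain rfl | rfl : j = i ∨ j = i + 2 := by omega
          · exact Or.inl rfl
          · exact Or.inr rfl)
        (hrl i (by omega)) (hrl (i + 1) (by omega))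
      refine ⟨n + k, k' + n', ?_, h2.trans h5, h6.trans h3⟩
      have := G.degree_le_maxDegree (c.getVert (i + 1))
      rw [Nat.mul_succ]
      omega
  obtain ⟨n, n', h1, h2, h3⟩ := key m le_rfl
  have hs := (hrl 0 (Nat.succ_pos m)).incident
  have ht := (hrl m (Nat.lt_succ_self m)).symm.incident
  rw [c.getVert_zero] at hs
  rw [← hm, c.getVert_length] at ht
  exact ⟨S, n, n', r 0, l 0, r m, l m, h1, hs.1, hs.2, ht.2, ht.1, h2, h3⟩

end PlanarEmbedding

open PlanarEmbedding in
theorem theorem3 {V : Type u} {F : Type w} [Fintype V] [Finite F] (G : SimpleGraph V)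
    [DecidableRel G.Adj] (M : PlanarEmbedding G F) (hΔ : 3 ≤ G.maxDegree) (s t : V) (hst : s ≠ t)
    (p : M.STWalk s t) (hp : PlanarEmbedding.IsShortestPath p) :
    ∃ q : M.STWalk s t, PlanarEmbedding.IsPath q ∧ PlanarEmbedding.Consistent q ∧
      q.length ≤ (G.maxDegree - 2) * p.length := by
  classical
  rcases hΔ.eq_or_lt with h3 | h4
  · exact ⟨p, hp.1, consistent_of_isPath h3.symm.le hp.1, by simp [← h3]⟩
  obtain ⟨c₀, hc₀⟩ := exists_cofacialGraph_walk p
  obtain ⟨c, hc⟩ := c₀.reachable.exists_walk_length_eq_dist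
  have hle := M.cofacialGraph.dist_le c₀
  obtain ⟨m, hm⟩ := Nat.exists_eq_succ_of_ne_zero
    (fun h => hst (SimpleGraph.Walk.eq_of_length_eq_zero h) : c.length ≠ 0)
  obtain ⟨S, n, n', f, g, h, k, hn, hf, hg, hh, hk, hw, hw'⟩ := exists_cutWalk_along c hc hm
  -- One of the two routes crosses at most `Δ m / 2` edges, which is at most `(Δ - 2) m`.
  obtain ⟨D, hD⟩ := Nat.exists_eq_add_of_lt h4
  have hlen : ∀ N, 2 * N ≤ G.maxDegree * m → N + 2 ≤ (G.maxDegree - 2) * p.length := by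
    intro N hN
    have hm' : m + 2 ≤ p.length := by omega
    refine le_trans ?_ (Nat.mul_le_mul_left _ hm')
    rw [hD, show 3 + D + 1 - 2 = D + 2 by omega]
    rw [hD] at hN
    nlinarith
  by_cases hnn : n ≤ n'
  · obtain ⟨q, hq, hq'⟩ := hw.exists_walk hf hh
    obtain ⟨q', h1, h2, h3⟩ := exists_isPath_of_walk q
    refine ⟨q', h1, ⟨fun v => if v ∈ S then .L else .R, fun d hd => ?_⟩, ?_⟩
    · obtain ⟨h4, h5⟩ := hq' d (h3 d hd)
      exact ⟨if_pos h4, if_neg h5⟩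
    · exact h2.trans (hq ▸ hlen n (by omega))
  · obtain ⟨q, hq, hq'⟩ := hw'.exists_walk_reverse hg hk
    obtain ⟨q', h1, h2, h3⟩ := exists_isPath_of_walk q
    refine ⟨q', h1, ⟨fun v => if v ∈ S then .R else .L, fun d hd => ?_⟩, ?_⟩
    · obtain ⟨h4, h5⟩ := hq' d (h3 d hd)
      exact ⟨if_neg h4, if_pos h5⟩
    · exact h2.trans (hq ▸ hlen n' (by omega))
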